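/- Fix $n\ge 1$ and work over $\mathbf{C}$. Let $\mathscr{U}$ be the category whose objects are finite sets $S$ with a weight function $S\to\{1,\dots,n\}$ and whose morphisms are the bijections along which weights do not decrease; let $\mathscr{D}$ have the same objects and as morphisms the bijections along which weights do not increase, so that inverting bijections identifies $\mathscr{D}$ with $\mathscr{U}^{\mathrm{op}}$. A $\mathscr{U}$-module is a functor from $\mathscr{U}$ to finite dimensional complex vector spaces supported on finitely many objects up to isomorphism (similarly for $\mathscr{D}$). A tuple $\underline{a}=(a_1,\dots,a_n)\in\mathbf{N}^n$ is regarded as the weighted set having $a_i$ elements of weight $i$, and $|\underline{a}|=a_1+\cdots+a_n$. Let $\mathbf{P}_{\underline{a}}$ be the principal projective $\mathscr{U}$-module $T\mapsto\mathbf{C}[\mathrm{Hom}_{\mathscr{U}}(\underline{a},T)]$, let $\mathbf{J}_{\underline{a}}$ be the principal injective $\mathscr{D}$-module $T\mapsto\mathbf{C}[\mathrm{Hom}_{\mathscr{D}}(T,\underline{a})]^*$, and for a $\mathscr{D}$-module $N$ let $N^\vee$ be the $\mathscr{U}$-module $S\mapsto N(S)^*$. Let $\mathbf{V}$ be the vector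 space with basis $e_{i,j}$, $1\le i\le n$, $j\ge 1$, with the flag $0=\mathbf{V}_0\subset\mathbf{V}_1\subset\cdots\subset\mathbf{V}_n=\mathbf{V}$, where $\mathbf{V}_m$ is spanned by the $e_{i,j}$ with $i\le m$, and put $\mathbf{V}_{(i)}=\mathbf{V}_i/\mathbf{V}_{i-1}$. Let $\mathbf{G}$ be the group of linear automorphisms of $\mathbf{V}$ that fix all but finitely many of the basis vectors and preserve the flag. Put $$T_{\underline{a}}=\bigotimes_{i=1}^n(\mathbf{V}/\mathbf{V}_{i-1})^{\otimes a_i},$$ and for a morphism $\varphi:\underline{a}\to\underline{b}$ of $\mathscr{U}$ let $T_{\underline{a}}\to T_{\underline{b}}$ be the map of $\mathbf{G}$-representations that surjects the tensor factor of each element $x$ onto the tensor factor of $\varphi(x)$. Let $K_{\underline{a}}=\bigcap\ker(T_{\underline{a}}\to T_{\underline{b}})$, the intersection being over all non-isomorphisms $\underline{a}\to\underline{b}$ in $\mathscr{U}$. Write $\underline{a}\ge\underline{b}$ (dominance order) if $a_1+\cdots+a_i\ge b_1+\cdots+b_i$ for all $i$. Then for every $\underline{a}\in\mathbf{N}^n$: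 1. The functor $\underline{b}\mapsto\mathrm{Hom}_{\mathbf{G}}(T_{\underline{a}},T_{\underline{b}})$ is a $\mathscr{U}$-module, and it is isomorphic to $\mathbf{P}_{\underline{a}}$ via the natural map sending a morphism $\varphi:\underline{a}\to\underline{b}$ to the induced map $T_{\underline{a}}\to T_{\underline{b}}$; moreover $\mathbf{P}_{\underline{a}}\cong(\mathbf{J}_{\underline{a}})^\vee$ via the map sending $\varphi$ to evaluation at $\varphi^{-1}$. In particular, $\mathrm{Hom}_{\mathbf{G}}(T_{\underline{a}},T_{\underline{b}})\ne 0$ if and only if $|\underline{a}|=|\underline{b}|$ and $\underline{a}\ge\underline{b}$, and whenever $|\underline{a}|=|\underline{b}|$, $$\dim\mathrm{Hom}_{\mathbf{G}}(T_{\underline{a}},T_{\underline{b}})=b_1!\,b_2!\cdots b_n!\,\prod_{i=1}^{n-1}\binom{(a_1+\cdots+a_i)-(b_1+\cdots+b_{i-1})}{b_i}.$$ 2. $K_{\underline{a}}=\bigotimes_{i=1}^n\mathbf{V}_{(i)}^{\otimes a_i}$: the map $\bigotimes_{i}\mathbf{V}_{(i)}^{\otimes a_i}\to T_{\underline{a}}$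 induced by the inclusions $\mathbf{V}_{(i)}\subseteq\mathbf{V}/\mathbf{V}_{i-1}$ is an isomorphism of $\mathbf{G}$-representations onto $K_{\underline{a}}$. -/

import Mathlib

open CategoryTheory
open scoped TensorProduct

noncomputable section

namespace FlagRep

/-! ### Weighted finite sets; the categories of upwards and of downwards bijections -/

/-- An `[n]`-weighted finite set, with weights numbered `0, …, n - 1`; objects of the category `𝒰`
of upwards bijections. -/
structure USet (n : ℕ) where
  carrier : Type
  [finite : Finite carrier]
  weight : carrier → Fin n

/-- The same objects, for the category `𝒟` of downwards bijections. -/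
structure DSet (n : ℕ) where
  carrier : Type
  [finite : Finite carrier]
  weight : carrier → Fin n

attribute [instance] USet.finite DSet.finite

/-- A bijection along which weights do not decrease. -/
@[ext]
structure UHom {n : ℕ} (S T : USet n) where
  toEquiv : S.carrier ≃ T.carrier
  weight_le : ∀ x, S.weight x ≤ T.weight (toEquiv x)

/-- A bijection along which weights do not increase. -/
@[ext]
structure DHom {n : ℕ} (S T : DSet n) where
  toEquiv : S.carrier ≃ T.carrier
  weight_le : ∀ x, T.weight (toEquiv x) ≤ S.weight x

instance (n : ℕ) : Category (USet n) where
  Hom S T := UHom S T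
  id S := ⟨Equiv.refl _, fun _ => le_rfl⟩
  comp f g := ⟨f.toEquiv.trans g.toEquiv,
    fun x => (f.weight_le x).trans (g.weight_le (f.toEquiv x))⟩

instance (n : ℕ) : Category (DSet n) where
  Hom S T := DHom S T
  id S := ⟨Equiv.refl _, fun _ => le_rfl⟩
  comp f g := ⟨f.toEquiv.trans g.toEquiv,
    fun x => (g.weight_le (f.toEquiv x)).trans (f.weight_le x)⟩

/-- The weighted set `([a₁], …, [aₙ])` in `𝒰` attached to a tuple `a`. -/
def USet.ofTuple {n : ℕ} (a : Fin n → ℕ) : USet n where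
  carrier := Σ i : Fin n, Fin (a i)
  weight x := x.1

/-- The identification of objects of `𝒰` and `𝒟`. -/
def USet.toD {n : ℕ} (S : USet n) : DSet n where
  carrier := S.carrier
  finite := S.finite
  weight := S.weight

/-- The identification of `𝒟` with the opposite of `𝒰`: the inverse of an upwards bijection
is a downwards bijection. -/
def UHom.inv {n : ℕ} {S T : USet n} (f : S ⟶ T) : T.toD ⟶ S.toD where
  toEquiv := f.toEquiv.symm
  weight_le y := by
    have h := f.weight_le (f.toEquiv.symm y)
    exact h.trans (congrArg T.weight (f.toEquiv.apply_symm_apply y)).le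

/-! ### Modules over these categories -/

/-- A functor `C ⥤ Vec_ℂ` is a module over `C` if its values are finite dimensional and it is
supported on finitely many objects up to isomorphism. -/
structure IsFiniteModule {C : Type 1} [Category.{0} C] (M : C ⥤ ModuleCat.{0} ℂ) : Prop where
  finite_obj : ∀ S, Module.Finite ℂ (M.obj S)
  finite_support : ∃ F : Set C, F.Finite ∧
    ∀ S, Nontrivial (M.obj S) → ∃ T ∈ F, Nonempty (S ≅ T)

/-- The principal projective `P_a : T ↦ ℂ[Hom_𝒰(a, T)]`. -/
def princProj {n : ℕ} (a : USet n) : USet n ⥤ ModuleCat.{0} ℂ where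
  obj T := ModuleCat.of ℂ ((a ⟶ T) →₀ ℂ)
  map f := ModuleCat.ofHom (Finsupp.lmapDomain ℂ ℂ (fun φ => φ ≫ f))
  map_id T := by
    ext : 1
    simp only [Category.comp_id]
    exact Finsupp.lmapDomain_id ℂ ℂ
  map_comp f g := by
    ext : 1
    simp only [← Category.assoc]
    exact Finsupp.lmapDomain_comp ℂ ℂ (fun φ => φ ≫ f) (fun φ => φ ≫ g)

/-- The principal injective `𝒟`-module `J_a : T ↦ ℂ[Hom_𝒟(T, a)]^*`. -/
def princInj {n : ℕ} (a : DSet n) : DSet n ⥤ ModuleCat.{0} ℂ where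
  obj T := ModuleCat.of ℂ (Module.Dual ℂ ((T ⟶ a) →₀ ℂ))
  map f := ModuleCat.ofHom (Finsupp.lmapDomain ℂ ℂ (fun φ => f ≫ φ)).dualMap
  map_id T := by
    ext : 1
    simp only [Category.id_comp]
    exact (congrArg LinearMap.dualMap (Finsupp.lmapDomain_id ℂ ℂ)).trans LinearMap.dualMap_id
  map_comp f g := by
    ext : 1
    simp only [Category.assoc]
    exact (congrArg LinearMap.dualMap
      (Finsupp.lmapDomain_comp ℂ ℂ (fun φ => g ≫ φ) (fun φ => f ≫ φ))).trans
      (LinearMap.dualMap_comp_dualMap _ _).symm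

/-- The dual `N^∨ : S ↦ N(S)^*` of a `𝒟`-module `N`, a `𝒰`-module. -/
def dualOfD {n : ℕ} (N : DSet n ⥤ ModuleCat.{0} ℂ) : USet n ⥤ ModuleCat.{0} ℂ where
  obj S := ModuleCat.of ℂ (Module.Dual ℂ (N.obj S.toD))
  map f := ModuleCat.ofHom (N.map (UHom.inv f)).hom.dualMap
  map_id S := by
    have h : UHom.inv (𝟙 S) = 𝟙 S.toD := rfl
    rw [h, N.map_id]
    rfl
  map_comp f g := by
    have h : UHom.inv (f ≫ g) = UHom.inv g ≫ UHom.inv f := rfl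
    rw [h, N.map_comp]
    rfl

/-! ### Generalities on representations -/

/-- The tensor product of a family of representations. -/
def tensorRep {G ι : Type} [Group G] {M : ι → Type} [∀ i, AddCommGroup (M i)]
    [∀ i, Module ℂ (M i)] (ρ : ∀ i, Representation ℂ G (M i)) :
    Representation ℂ G (⨂[ℂ] i, M i) where
  toFun g := PiTensorProduct.map fun i => ρ i g
  map_one' := by
    simp only [map_one]
    exact PiTensorProduct.map_one
  map_mul' g h := by
    simp only [map_mul]
    exact PiTensorProduct.map_mul _ _

lemma tensorRep_tprod {G ι : Type} [Group G] {M : ι → Type} [∀ i, AddCommGroup (M i)]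
    [∀ i, Module ℂ (M i)] (ρ : ∀ i, Representation ℂ G (M i)) (g : G) (v : ∀ i, M i) :
    tensorRep ρ g (PiTensorProduct.tprod ℂ v) = PiTensorProduct.tprod ℂ fun i => ρ i g (v i) :=
  PiTensorProduct.map_tprod _ _

/-- The tensor product of a family of equivariant maps. -/
def tensorMap {G ι : Type} [Group G] {M N : ι → Type} [∀ i, AddCommGroup (M i)]
    [∀ i, Module ℂ (M i)] [∀ i, AddCommGroup (N i)] [∀ i, Module ℂ (N i)]
    {ρ : ∀ i, Representation ℂ G (M i)} {σ : ∀ i, Representation ℂ G (N i)}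
    (f : ∀ i, (ρ i).IntertwiningMap (σ i)) : (tensorRep ρ).IntertwiningMap (tensorRep σ) :=
  ⟨PiTensorProduct.map fun i => (f i).toLinearMap, fun g => by
    apply PiTensorProduct.ext
    apply MultilinearMap.ext
    intro v
    simp only [LinearMap.compMultilinearMap_apply, LinearMap.comp_apply, tensorRep_tprod,
      PiTensorProduct.map_tprod]
    congr 1
    funext i
    exact LinearMap.congr_fun ((f i).2 g) (v i)⟩

/-- Given representations `ρ m` and equivariant maps `ρ l → ρ m` for `l ≤ m`, the map
`⨂_{x ∈ X} ρ (w x) → ⨂_{y ∈ Y} ρ (w' y)` induced by a bijection `e : X ≃ Y` with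
`w x ≤ w' (e x)`: the tensor factor at `x` is mapped to the tensor factor at `e x`. -/
def transport {G X Y : Type} [Group G] {M : ℕ → Type} [∀ m, AddCommGroup (M m)]
    [∀ m, Module ℂ (M m)] {ρ : ∀ m, Representation ℂ G (M m)}
    (p : ∀ l m, l ≤ m → (ρ l).IntertwiningMap (ρ m)) {w : X → ℕ} {w' : Y → ℕ} (e : X ≃ Y)
    (h : ∀ y, w (e.symm y) ≤ w' y) :
    (tensorRep fun x => ρ (w x)).IntertwiningMap (tensorRep fun y => ρ (w' y)) :=
  ⟨PiTensorProduct.map (fun y => (p _ _ (h y)).toLinearMap) ∘ₗ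
    (PiTensorProduct.reindex ℂ (fun x => M (w x)) e).toLinearMap, fun g => by
    apply PiTensorProduct.ext
    apply MultilinearMap.ext
    intro v
    simp only [LinearMap.compMultilinearMap_apply, LinearMap.comp_apply, tensorRep_tprod,
      PiTensorProduct.map_tprod, LinearEquiv.coe_coe, PiTensorProduct.reindex_tprod]
    congr 1
    funext y
    exact LinearMap.congr_fun ((p _ _ (h y)).2 g) (v (e.symm y))⟩

lemma transport_tprod {G X Y : Type} [Group G] {M : ℕ → Type} [∀ m, AddCommGroup (M m)]
    [∀ m, Module ℂ (M m)] {ρ : ∀ m, Representation ℂ G (M m)}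
    (p : ∀ l m, l ≤ m → (ρ l).IntertwiningMap (ρ m)) {w : X → ℕ} {w' : Y → ℕ} (e : X ≃ Y)
    (h : ∀ y, w (e.symm y) ≤ w' y) (v : ∀ x, M (w x)) :
    (transport p e h).toLinearMap (PiTensorProduct.tprod ℂ v) =
      PiTensorProduct.tprod ℂ fun y => (p _ _ (h y)).toLinearMap (v (e.symm y)) := by
  simp only [transport, LinearMap.comp_apply, LinearEquiv.coe_coe,
    PiTensorProduct.reindex_tprod, PiTensorProduct.map_tprod]

lemma transport_refl {G X : Type} [Group G] {M : ℕ → Type} [∀ m, AddCommGroup (M m)]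
    [∀ m, Module ℂ (M m)] {ρ : ∀ m, Representation ℂ G (M m)}
    (p : ∀ l m, l ≤ m → (ρ l).IntertwiningMap (ρ m))
    (p_refl : ∀ m v, (p m m le_rfl).toLinearMap v = v) {w : X → ℕ} :
    transport p (w := w) (w' := w) (Equiv.refl X) (fun _ => le_rfl) = .id _ := by
  apply Representation.IntertwiningMap.toLinearMap_injective
  apply PiTensorProduct.ext
  apply MultilinearMap.ext
  intro v
  change (transport p (Equiv.refl X) fun _ => le_rfl).toLinearMap (PiTensorProduct.tprod ℂ v) =
    PiTensorProduct.tprod ℂ v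
  rw [transport_tprod]
  congr 1
  funext y
  exact p_refl _ _

lemma transport_trans {G X Y Z : Type} [Group G] {M : ℕ → Type} [∀ m, AddCommGroup (M m)]
    [∀ m, Module ℂ (M m)] {ρ : ∀ m, Representation ℂ G (M m)}
    (p : ∀ l m, l ≤ m → (ρ l).IntertwiningMap (ρ m))
    (p_trans : ∀ l m k (h : l ≤ m) (h' : m ≤ k) v,
      (p m k h').toLinearMap ((p l m h).toLinearMap v) = (p l k (h.trans h')).toLinearMap v)
    {w : X → ℕ} {w' : Y → ℕ} {w'' : Z → ℕ} (e : X ≃ Y) (e' : Y ≃ Z)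
    (h : ∀ y, w (e.symm y) ≤ w' y) (h' : ∀ z, w' (e'.symm z) ≤ w'' z)
    (h'' : ∀ z, w ((e.trans e').symm z) ≤ w'' z) :
    transport p (e.trans e') h'' = (transport p e' h').comp (transport p e h) := by
  apply Representation.IntertwiningMap.toLinearMap_injective
  apply PiTensorProduct.ext
  apply MultilinearMap.ext
  intro v
  change (transport p (e.trans e') h'').toLinearMap (PiTensorProduct.tprod ℂ v) =
    (transport p e' h').toLinearMap ((transport p e h).toLinearMap (PiTensorProduct.tprod ℂ v))
  simp only [transport_tprod]
  congr 1
  funext y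
  exact (p_trans _ _ _ _ _ _).symm

/-- The surjection `V / W → V / W'` for subrepresentations `W ≤ W'` of `V`. -/
def quotFactor {G V : Type} [Group G] [AddCommGroup V] [Module ℂ V] (ρ : Representation ℂ G V)
    {W W' : Submodule ℂ V} (hW : ∀ g, W ≤ W.comap (ρ g)) (hW' : ∀ g, W' ≤ W'.comap (ρ g))
    (h : W ≤ W') : (ρ.quotient W hW).IntertwiningMap (ρ.quotient W' hW') :=
  ⟨Submodule.factor h, fun g => by
    apply LinearMap.ext
    intro v
    obtain ⟨v, rfl⟩ := Submodule.Quotient.mk_surjective _ v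
    rfl⟩

lemma quotFactor_refl {G V : Type} [Group G] [AddCommGroup V] [Module ℂ V]
    (ρ : Representation ℂ G V) {W : Submodule ℂ V} (hW : ∀ g, W ≤ W.comap (ρ g)) (v : V ⧸ W) :
    (quotFactor ρ hW hW le_rfl).toLinearMap v = v := by
  obtain ⟨v, rfl⟩ := Submodule.Quotient.mk_surjective _ v
  rfl

lemma quotFactor_trans {G V : Type} [Group G] [AddCommGroup V] [Module ℂ V]
    (ρ : Representation ℂ G V) {W W' W'' : Submodule ℂ V} (hW : ∀ g, W ≤ W.comap (ρ g))
    (hW' : ∀ g, W' ≤ W'.comap (ρ g)) (hW'' : ∀ g, W'' ≤ W''.comap (ρ g)) (h : W ≤ W')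
    (h' : W' ≤ W'') (v : V ⧸ W) :
    (quotFactor ρ hW' hW'' h').toLinearMap ((quotFactor ρ hW hW' h).toLinearMap v) =
      (quotFactor ρ hW hW'' (h.trans h')).toLinearMap v := by
  obtain ⟨v, rfl⟩ := Submodule.Quotient.mk_surjective _ v
  rfl

/-- For subrepresentations `W ≤ U` of `V`, the representation `U / W`. -/
def subquotRep {G V : Type} [Group G] [AddCommGroup V] [Module ℂ V] (ρ : Representation ℂ G V)
    {W U : Submodule ℂ V} (hW : ∀ g, W ≤ W.comap (ρ g)) (hU : ∀ g, U ≤ U.comap (ρ g)) :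
    Representation ℂ G (U ⧸ W.comap U.subtype) :=
  (ρ.subrepresentation U hU).quotient (W.comap U.subtype) fun g _ hv => hW g hv

/-- The inclusion `U / W → V / W`. -/
def subquotIncl {G V : Type} [Group G] [AddCommGroup V] [Module ℂ V] (ρ : Representation ℂ G V)
    {W U : Submodule ℂ V} (hW : ∀ g, W ≤ W.comap (ρ g)) (hU : ∀ g, U ≤ U.comap (ρ g)) :
    (subquotRep ρ hW hU).IntertwiningMap (ρ.quotient W hW) :=
  ⟨Submodule.mapQ (W.comap U.subtype) W U.subtype le_rfl, fun g => by
    apply LinearMap.ext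
    intro v
    obtain ⟨v, rfl⟩ := Submodule.Quotient.mk_surjective _ v
    rfl⟩

/-! ### The standard representation, its flag, and the infinite rank parabolic group -/

/-- The standard representation `𝐕`: finitely supported functions on the index set of the basis
`e_{i,j}`, `i ∈ Fin n`, `j ∈ ℕ`. -/
def StdV (n : ℕ) : Type := (Fin n × ℕ) →₀ ℂ

instance (n : ℕ) : AddCommGroup (StdV n) := inferInstanceAs (AddCommGroup ((Fin n × ℕ) →₀ ℂ))

instance (n : ℕ) : Module ℂ (StdV n) := inferInstanceAs (Module ℂ ((Fin n × ℕ) →₀ ℂ))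

/-- The basis `e_{i,j}` of `𝐕`. -/
def stdE (n : ℕ) : Module.Basis (Fin n × ℕ) ℂ (StdV n) :=
  Module.Basis.ofRepr (LinearEquiv.refl ℂ ((Fin n × ℕ) →₀ ℂ))

/-- The `m`-th step `𝐕_m` of the flag, `0 ≤ m ≤ n`, spanned by the vectors of the first `m`
blocks. -/
def flag (n m : ℕ) : Submodule ℂ (StdV n) :=
  Submodule.span ℂ (stdE n '' {p | p.1.val < m})

lemma flag_mono (n : ℕ) {l m : ℕ} (h : l ≤ m) : flag n l ≤ flag n m :=
  Submodule.span_mono (Set.image_mono fun _ hp => lt_of_lt_of_le hp h)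

/-- `𝐆𝐋 = ⋃ᵢ GLᵢ(ℂ)`: the linear automorphisms of `𝐕` that fix all but finitely many basis
vectors. -/
def GLInf (n : ℕ) : Subgroup (StdV n ≃ₗ[ℂ] StdV n) where
  carrier := {g | {p | g (stdE n p) ≠ stdE n p}.Finite}
  mul_mem' := by
    intro g h hg hh
    refine (hg.union hh).subset fun p hp => ?_
    by_contra hc
    simp only [Set.mem_union, Set.mem_ofPred_eq, not_or, not_not] at hc
    exact hp (by rw [LinearEquiv.mul_apply, hc.2, hc.1])
  one_mem' := by simp
  inv_mem' := by
    intro g hg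
    refine Set.Finite.subset hg fun p hp hc => hp ?_
    change g.symm (stdE n p) = stdE n p
    rw [LinearEquiv.symm_apply_eq, hc]

/-- The automorphisms of `𝐕` that preserve the flag. -/
def flagStab (n : ℕ) : Subgroup (StdV n ≃ₗ[ℂ] StdV n) where
  carrier := {g | ∀ m, (flag n m).map g.toLinearMap = flag n m}
  mul_mem' := by
    intro g h hg hh m
    have e : (g * h).toLinearMap = g.toLinearMap ∘ₗ h.toLinearMap := rfl
    rw [e, Submodule.map_comp, hh m, hg m]
  one_mem' := fun m => Submodule.map_id _
  inv_mem' := by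
    intro g hg m
    have e : (g⁻¹).toLinearMap ∘ₗ g.toLinearMap = LinearMap.id :=
      LinearMap.ext fun v => g.symm_apply_apply v
    conv_lhs => rw [← hg m, ← Submodule.map_comp, e, Submodule.map_id]

/-- The group `𝐆` of invertible block upper triangular matrices. -/
def Gpar (n : ℕ) : Subgroup (StdV n ≃ₗ[ℂ] StdV n) := GLInf n ⊓ flagStab n

/-- The standard representation of `𝐆` on `𝐕`. -/
def stdRep (n : ℕ) : Representation ℂ (Gpar n) (StdV n) where
  toFun g := g.1.toLinearMap
  map_one' := rfl
  map_mul' _ _ := rfl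

lemma flag_le_comap (n m : ℕ) (g : Gpar n) : flag n m ≤ (flag n m).comap (stdRep n g) :=
  Submodule.map_le_iff_le_comap.mp (g.2.2 m).le

/-- The underlying space of `𝐕 / 𝐕_m`. -/
def QuotV (n m : ℕ) : Type := StdV n ⧸ flag n m

instance (n m : ℕ) : AddCommGroup (QuotV n m) := inferInstanceAs (AddCommGroup (StdV n ⧸ flag n m))

instance (n m : ℕ) : Module ℂ (QuotV n m) := inferInstanceAs (Module ℂ (StdV n ⧸ flag n m))

/-- The representation `𝐕 / 𝐕_m`. -/
def quotRep (n m : ℕ) : Representation ℂ (Gpar n) (QuotV n m) :=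
  (stdRep n).quotient (flag n m) (flag_le_comap n m)

/-- The surjection `𝐕 / 𝐕_l → 𝐕 / 𝐕_m` for `l ≤ m`. -/
def proj (n l m : ℕ) (h : l ≤ m) : (quotRep n l).IntertwiningMap (quotRep n m) :=
  quotFactor (stdRep n) (flag_le_comap n l) (flag_le_comap n m) (flag_mono n h)

lemma proj_refl (n m : ℕ) (v : QuotV n m) : (proj n m m le_rfl).toLinearMap v = v :=
  quotFactor_refl (stdRep n) (flag_le_comap n m) v

lemma proj_trans (n l m k : ℕ) (h : l ≤ m) (h' : m ≤ k) (v : QuotV n l) :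
    (proj n m k h').toLinearMap ((proj n l m h).toLinearMap v) =
      (proj n l k (h.trans h')).toLinearMap v :=
  quotFactor_trans (stdRep n) (flag_le_comap n l) (flag_le_comap n m) (flag_le_comap n k)
    (flag_mono n h) (flag_mono n h') v

/-- The underlying space of the graded piece `𝐕_{m+1} / 𝐕_m`. -/
def GrV (n m : ℕ) : Type := flag n (m + 1) ⧸ (flag n m).comap (flag n (m + 1)).subtype

instance (n m : ℕ) : AddCommGroup (GrV n m) :=
  inferInstanceAs (AddCommGroup (flag n (m + 1) ⧸ (flag n m).comap (flag n (m + 1)).subtype))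

instance (n m : ℕ) : Module ℂ (GrV n m) :=
  inferInstanceAs (Module ℂ (flag n (m + 1) ⧸ (flag n m).comap (flag n (m + 1)).subtype))

/-- The representation `𝐕_{m+1} / 𝐕_m`. -/
def grRep (n m : ℕ) : Representation ℂ (Gpar n) (GrV n m) :=
  subquotRep (stdRep n) (flag_le_comap n m) (flag_le_comap n (m + 1))

/-- The inclusion `𝐕_{m+1} / 𝐕_m → 𝐕 / 𝐕_m`. -/
def grIncl (n m : ℕ) : (grRep n m).IntertwiningMap (quotRep n m) :=
  subquotIncl (stdRep n) (flag_le_comap n m) (flag_le_comap n (m + 1))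

/-! ### The representations `T_a` and `K_a` -/

/-- The representation `T_S = ⨂_{x ∈ S} 𝐕 / 𝐕_{i-1}`, where `i` is the weight of `x` in the
numbering `1, …, n`. For the tuple `a` this is `⨂ᵢ (𝐕 / 𝐕_{i-1})^{⊗ aᵢ}`. -/
def TRep {n : ℕ} (S : USet n) : Rep.{0} ℂ (Gpar n) :=
  Rep.of (tensorRep fun x : S.carrier => quotRep n (S.weight x).val)

lemma weight_symm_le {n : ℕ} {S T : USet n} (f : S ⟶ T) (y : T.carrier) :
    (S.weight (f.toEquiv.symm y)).val ≤ (T.weight y).val := by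
  have h := f.weight_le (f.toEquiv.symm y)
  rw [Equiv.apply_symm_apply] at h
  exact h

/-- The map `T_S → T_T` attached to `f : S ⟶ T`: the tensor factor at `x` is surjected onto the
tensor factor at `f x`. -/
def TMap {n : ℕ} {S T : USet n} (f : S ⟶ T) : TRep S ⟶ TRep T :=
  Rep.ofHom (transport (proj n) (w := fun x => (S.weight x).val) (w' := fun y => (T.weight y).val)
    f.toEquiv (weight_symm_le f))

/-- The functor `𝒯 : 𝒰 ⥤ Rep(𝐆)`, `a ↦ T_a`. -/
def TFunctor (n : ℕ) : USet n ⥤ Rep.{0} ℂ (Gpar n) where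
  obj S := TRep S
  map f := TMap f
  map_id S := congrArg (fun F => Rep.ofHom F)
    (transport_refl (proj n) (proj_refl n) (w := fun x : S.carrier => (S.weight x).val))
  map_comp {R S T} f g := congrArg (fun F => Rep.ofHom F)
    (transport_trans (proj n) (proj_trans n) (w := fun x => (R.weight x).val)
      (w' := fun x => (S.weight x).val) (w'' := fun x => (T.weight x).val) f.toEquiv g.toEquiv
      (weight_symm_le f) (weight_symm_le g) (weight_symm_le (f ≫ g)))

/-- The `𝒰`-module `b ↦ Hom_𝐆(T_a, T_b)`, with `𝒰` acting by post-composition. -/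
def homT {n : ℕ} (a : USet n) : USet n ⥤ ModuleCat.{0} ℂ :=
  TFunctor n ⋙ (linearCoyoneda ℂ (Rep.{0} ℂ (Gpar n))).obj (Opposite.op ((TFunctor n).obj a))

/-- The subspace `⋂ ker (T_a → T_b)` of `T_a`, over all non-isomorphisms `a ⟶ b` in `𝒰`. -/
def KSub {n : ℕ} (a : USet n) : Submodule ℂ ((TFunctor n).obj a) :=
  ⨅ (b : USet n) (f : a ⟶ b) (_ : ¬ IsIso f), LinearMap.ker ((TFunctor n).map f).hom.toLinearMap

lemma KSub_le_comap {n : ℕ} (a : USet n) (g : Gpar n) :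
    KSub a ≤ (KSub a).comap (((TFunctor n).obj a).ρ g) := by
  intro v hv
  simp only [KSub, Submodule.mem_comap, Submodule.mem_iInf, LinearMap.mem_ker] at hv ⊢
  intro b f hf
  have h := Rep.hom_comm_apply ((TFunctor n).map f) g v
  have h' : ((TFunctor n).map f).hom v = 0 := hv b f hf
  rw [h', map_zero] at h
  exact h

/-- The representation `K_a`. -/
def KRep {n : ℕ} (a : USet n) : Rep.{0} ℂ (Gpar n) :=
  Rep.subrepresentation ((TFunctor n).obj a) (KSub a) (KSub_le_comap a)

/-- The inclusion `K_a → T_a`. -/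
def KIncl {n : ℕ} (a : USet n) : KRep a ⟶ (TFunctor n).obj a :=
  Rep.subtype ((TFunctor n).obj a) (KSub a) (KSub_le_comap a)

/-- The representation `⨂_{x ∈ S} 𝐕_{(i)}`, where `i` is the weight of `x`. For the tuple `a`
this is `⨂ᵢ 𝐕_{(i)}^{⊗ aᵢ}`. -/
def GrTRep {n : ℕ} (S : USet n) : Rep.{0} ℂ (Gpar n) :=
  Rep.of (tensorRep fun x : S.carrier => grRep n (S.weight x).val)

/-- The map `⨂ 𝐕_{(i)} → ⨂ 𝐕 / 𝐕_{i-1}` induced by the inclusions `𝐕_{(i)} ⊆ 𝐕 / 𝐕_{i-1}`. -/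
def grTIncl {n : ℕ} (S : USet n) : GrTRep S ⟶ (TFunctor n).obj S :=
  Rep.ofHom (tensorMap fun x : S.carrier => grIncl n (S.weight x).val)

/-! ### Dominance order -/

/-- `a ≥ b` for tuples with the same sum in the dominance order: every partial sum of `a` is at
least that of `b`. -/
def Dominates {n : ℕ} (a b : Fin n → ℕ) : Prop :=
  ∀ i, ∑ j ∈ Finset.Iic i, b j ≤ ∑ j ∈ Finset.Iic i, a j

end FlagRep

end

open FlagRep

/-!
Let `S`, `T` be weighted sets and let `t` be the tensor of pairwise distinct basis vectors
`e_{n, j x}`, `x ∈ S`, of the top block. It generates `T_S`, since transvections in `𝐆` move its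
factors to arbitrary basis vectors one at a time, so an equivariant `F : T_S → T_T` is determined by
`F t`. The elements of `𝐆` doubling one basis vector show that every monomial in `F t` has the same
factors as `t`, permuted by a bijection `S ≃ T`. If the bijection lowered a weight, some
transvection would fix `t` but not `F t`. Hence `F t` is a combination of the images of `t` under
the morphisms `S ⟶ T`, and these images are distinct monomials.

A morphism acts on monomials by moving the factors, and kills those with a factor that vanishes in
its new place. So an element of `K_S` involves only monomials whose factor at each `x` lies in the
block of the weight of `x`: any other monomial survives in some `T_T` of larger weights.

The inverses of morphisms `a ⟶ b` are the injections `b → a` along which weights do not increase.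
They are counted by choosing the values on the elements of `b` in order of increasing weight.
-/

noncomputable section

namespace FlagRep

/-! ### Linear algebra -/

section LinearAlgebra

variable {R V ι : Type*} [CommRing R] [AddCommGroup V] [Module R V]

lemma mem_span_image_iff_repr_eq_zero (b : Module.Basis ι R V) {s : Set ι} {v : V} :
    v ∈ Submodule.span R (b '' s) ↔ ∀ i ∉ s, b.repr v i = 0 := by
  rw [b.mem_span_image]
  refine forall_congr' fun i => ?_
  rw [Finset.mem_coe, Finsupp.mem_support_iff, not_imp_comm]

/-- The basis of `V ⧸ span (b '' s)` formed by the images of the `b i` with `i ∉ s`, used for the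
quotients of `𝐕` by the steps of its flag. -/
def quotientSpanBasis (b : Module.Basis ι R V) (s : Set ι) :
    Module.Basis {i // i ∉ s} R (V ⧸ Submodule.span R (b '' s)) :=
  .ofRepr <| .ofBijective
    ((Submodule.span R (b '' s)).liftQ
      (Finsupp.lsubtypeDomain {i | i ∉ s} ∘ₗ b.repr.toLinearMap)
      fun _ hv => LinearMap.mem_ker.mpr <| Finsupp.ext fun i : {i // i ∉ s} =>
        (mem_span_image_iff_repr_eq_zero b).mp hv i i.2) <| by
    constructor
    · rw [injective_iff_map_eq_zero]
      rintro ⟨v⟩ hv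
      exact (Submodule.Quotient.mk_eq_zero _).mpr <| (mem_span_image_iff_repr_eq_zero b).mpr
        fun i hi => DFunLike.congr_fun hv (⟨i, hi⟩ : {i // i ∉ s})
    · intro f
      refine ⟨Submodule.Quotient.mk (b.repr.symm (f.mapDomain Subtype.val)),
        Finsupp.ext fun i : {i // i ∉ s} => ?_⟩
      change b.repr (b.repr.symm (f.mapDomain Subtype.val)) i.1 = f i
      rw [b.repr.apply_symm_apply, Finsupp.mapDomain_apply Subtype.val_injective]

lemma quotientSpanBasis_repr_mk (b : Module.Basis ι R V) (s : Set ι) (v : V) (i : {i // i ∉ s}) :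
    (quotientSpanBasis b s).repr (Submodule.Quotient.mk v) i = b.repr v i.1 := rfl

lemma quotientSpanBasis_apply (b : Module.Basis ι R V) (s : Set ι) (i : {i // i ∉ s}) :
    quotientSpanBasis b s i = Submodule.Quotient.mk (b i.1) := by
  classical
  apply (quotientSpanBasis b s).repr.injective
  ext k
  simp only [quotientSpanBasis_repr_mk, Module.Basis.repr_self, Finsupp.single_apply,
    Subtype.ext_iff]

lemma coord_basis_self (b : Module.Basis ι R V) (i : ι) : b.coord i (b i) = 1 := by
  rw [b.coord_apply, b.repr_self, Finsupp.single_eq_same]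

lemma coord_basis_of_ne (b : Module.Basis ι R V) {i k : ι} (h : k ≠ i) : b.coord i (b k) = 0 := by
  rw [b.coord_apply, b.repr_self, Finsupp.single_eq_of_ne h.symm]

lemma repr_apply_of_forall_eq_smul (b : Module.Basis ι R V) {D : V →ₗ[R] V} {c : ι → R}
    (h : ∀ i, D (b i) = c i • b i) (v : V) (i : ι) : b.repr (D v) i = c i * b.repr v i := by
  suffices b.coord i ∘ₗ D = c i • b.coord i from LinearMap.congr_fun this v
  refine b.ext fun k => ?_
  change b.repr (D (b k)) i = c i * b.repr (b k) i
  rw [h, map_smul, b.repr_self, Finsupp.smul_apply, smul_eq_mul]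
  obtain rfl | hk := eq_or_ne i k
  · rfl
  · rw [Finsupp.single_eq_of_ne hk, mul_zero, mul_zero]

lemma map_dilatransvection_eq {f : Module.Dual R V} {u : V} (h : IsUnit (1 + f u))
    {W : Submodule R V} (hW : W ≤ LinearMap.ker f ∨ u ∈ W) :
    W.map (LinearEquiv.dilatransvection h).toLinearMap = W := by
  have apply_eq (v : V) : LinearEquiv.dilatransvection h v = v + f v • u :=
    LinearEquiv.dilatransvection.apply
  obtain hW | hu := hW
  · have fixed (v : V) (hv : v ∈ W) : LinearEquiv.dilatransvection h v = v := by
      rw [apply_eq, LinearMap.mem_ker.mp (hW hv), zero_smul, add_zero]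
    refine le_antisymm ?_ fun v hv => ⟨v, hv, fixed v hv⟩
    rintro _ ⟨v, hv, rfl⟩
    exact (fixed v hv).symm ▸ hv
  · ext v
    obtain ⟨v, rfl⟩ := (LinearEquiv.dilatransvection h).surjective v
    refine W.mem_map_equiv.trans ?_
    rw [LinearEquiv.symm_apply_apply, apply_eq, W.add_mem_iff_left (W.smul_mem _ hu)]

end LinearAlgebra

section Multilinear

variable {R α V N : Type*} [CommSemiring R] [AddCommMonoid V] [Module R V]
  [AddCommMonoid N] [Module R N]

lemma map_add_smul_of_forall_ne_eq_zero [DecidableEq α] (F : MultilinearMap R (fun _ : α => V) N)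
    (f : Module.Dual R V) (u : V) (v : α → V) (x₀ : α) (h : ∀ x ≠ x₀, f (v x) = 0) :
    F (fun x => v x + f (v x) • u) = F v + f (v x₀) • F (Function.update v x₀ u) := by
  have : (fun x => v x + f (v x) • u) = Function.update v x₀ (v x₀ + f (v x₀) • u) := by
    funext x
    obtain rfl | hx := eq_or_ne x x₀
    · rw [Function.update_self]
    · rw [Function.update_of_ne hx, h x hx, zero_smul, add_zero]
  rw [this, F.map_update_add, F.map_update_smul, Function.update_eq_self]

end Multilinear

lemma piTensorProduct_map_injective {k ι : Type*} [Field k] {M N : ι → Type*}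
    [∀ i, AddCommGroup (M i)] [∀ i, Module k (M i)] [∀ i, AddCommGroup (N i)] [∀ i, Module k (N i)]
    {f : ∀ i, M i →ₗ[k] N i} (hf : ∀ i, Function.Injective (f i)) :
    Function.Injective (PiTensorProduct.map f) := by
  choose g hg using fun i => (f i).exists_leftInverse_of_injective (LinearMap.ker_eq_bot.mpr (hf i))
  refine Function.LeftInverse.injective (g := PiTensorProduct.map g) fun t => ?_
  rw [← LinearMap.comp_apply, ← PiTensorProduct.map_comp]
  simp only [hg, PiTensorProduct.map_id, LinearMap.id_apply]

lemma exists_equiv_comp_eq_of_card_fiber_eq {α β γ : Type*} [Finite α] [Finite β] {f : α → γ}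
    {g : β → γ} (h : ∀ c, Nat.card {x // f x = c} = Nat.card {y // g y = c}) :
    ∃ e : α ≃ β, ∀ x, g (e x) = f x :=
  ⟨Equiv.ofFiberEquiv fun c => (Finite.card_eq.mp (h c)).some, Equiv.ofFiberEquiv_map _⟩

/-! ### Elementary elements of `𝐆` -/

section Elementary

variable {n : ℕ} {p p' : Fin n × ℕ}

lemma isUnit_one_add_coord_stdE (p p' : Fin n × ℕ) :
    IsUnit (1 + (stdE n).coord p (stdE n p')) := by
  obtain rfl | h := eq_or_ne p' p
  · rw [coord_basis_self]
    norm_num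
  · rw [coord_basis_of_ne _ h, add_zero]
    exact isUnit_one

/-- The element of `𝐆` sending `e_p` to `e_p + e_{p'}` and fixing the other basis vectors. For
`p = p'` it doubles `e_p`, and its eigenvalues count how often `e_p` occurs in a monomial. -/
def elementary (h : p'.1 ≤ p.1) : Gpar n :=
  ⟨.dilatransvection (isUnit_one_add_coord_stdE p p'), by
    refine ⟨(Set.finite_singleton p).subset fun r hr => ?_, fun m => map_dilatransvection_eq _ ?_⟩
    · by_contra hrp
      refine hr (LinearEquiv.dilatransvection.apply.trans ?_)
      rw [coord_basis_of_ne _ hrp, zero_smul, add_zero]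
    · obtain hm | hm := lt_or_ge p'.1.val m
      · exact .inr (Submodule.subset_span ⟨p', hm, rfl⟩)
      · exact .inl fun v hv => LinearMap.mem_ker.mpr <|
          (mem_span_image_iff_repr_eq_zero (stdE n)).mp hv p (hm.trans h).not_gt⟩

lemma stdRep_elementary (h : p'.1 ≤ p.1) (v : StdV n) :
    stdRep n (elementary h) v = v + (stdE n).coord p v • stdE n p' :=
  LinearEquiv.dilatransvection.apply (h := isUnit_one_add_coord_stdE p p')

end Elementary

/-! ### Monomials in `T_S` -/

section Quotient

variable {n m : ℕ}

/-- The quotient map `𝐕 → 𝐕 / 𝐕_m`. -/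
def quotMk (n m : ℕ) : StdV n →ₗ[ℂ] QuotV n m := (flag n m).mkQ

lemma quotMk_surjective (n m : ℕ) : Function.Surjective (quotMk n m) :=
  Submodule.mkQ_surjective _

lemma quotMk_eq_zero {v : StdV n} : quotMk n m v = 0 ↔ v ∈ flag n m :=
  Submodule.Quotient.mk_eq_zero _

/-- The basis of `𝐕 / 𝐕_m` formed by the images of the `e_{i,j}` outside `𝐕_m`. -/
def quotBasis (n m : ℕ) : Module.Basis {p : Fin n × ℕ // m ≤ p.1.val} ℂ (QuotV n m) :=
  (quotientSpanBasis (stdE n) {p | p.1.val < m}).reindex <|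
    Equiv.subtypeEquivRight fun p => not_lt (a := p.1.val) (b := m)

lemma quotBasis_repr_quotMk (v : StdV n) (p : {p : Fin n × ℕ // m ≤ p.1.val}) :
    (quotBasis n m).repr (quotMk n m v) p = (stdE n).repr v p :=
  Module.Basis.repr_reindex_apply ..

lemma quotBasis_apply (p : {p : Fin n × ℕ // m ≤ p.1.val}) :
    quotBasis n m p = quotMk n m (stdE n p) :=
  ((quotientSpanBasis (stdE n) {p | p.1.val < m}).reindex_apply _ p).trans
    (quotientSpanBasis_apply ..)

end Quotient

section Tensor

variable {n : ℕ} {S T : USet n}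

/-- The representation `T_S`, unbundled. -/
abbrev tRep (S : USet n) :
    Representation ℂ (Gpar n) (⨂[ℂ] x : S.carrier, QuotV n (S.weight x).val) :=
  tensorRep fun x => quotRep n (S.weight x).val

/-- The linear map underlying the map `T_S → T_T` of a morphism `S ⟶ T`. -/
abbrev tMap (f : S ⟶ T) :
    (⨂[ℂ] x : S.carrier, QuotV n (S.weight x).val) →ₗ[ℂ]
      ⨂[ℂ] y : T.carrier, QuotV n (T.weight y).val :=
  ((TFunctor n).map f).hom.toLinearMap

/-- The tensor `⨂ v x` in `T_S` of a family of vectors of `𝐕`. Working with representatives in `𝐕`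
makes the formulas independent of the weights of `S`. -/
def mkTensor (S : USet n) : MultilinearMap ℂ (fun _ : S.carrier => StdV n)
    (⨂[ℂ] x : S.carrier, QuotV n (S.weight x).val) :=
  (PiTensorProduct.tprod ℂ).compLinearMap fun x => quotMk n (S.weight x).val

lemma linearMap_ext_mkTensor {N : Type*} [AddCommMonoid N] [Module ℂ N]
    {F F' : (⨂[ℂ] x : S.carrier, QuotV n (S.weight x).val) →ₗ[ℂ] N}
    (h : ∀ v, F (mkTensor S v) = F' (mkTensor S v)) : F = F' := by
  ext u
  choose v hv using fun x => quotMk_surjective n (S.weight x).val (u x)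
  obtain rfl := funext hv
  exact h v

lemma tRep_mkTensor (g : Gpar n) (v : S.carrier → StdV n) :
    tRep S g (mkTensor S v) = mkTensor S fun x => stdRep n g (v x) :=
  tensorRep_tprod ..

lemma tMap_mkTensor (f : S ⟶ T) (v : S.carrier → StdV n) :
    tMap f (mkTensor S v) = mkTensor T (v ∘ f.toEquiv.symm) :=
  transport_tprod (proj n) f.toEquiv (weight_symm_le f) fun x => quotMk n (S.weight x).val (v x)

lemma mkTensor_eq_zero {v : S.carrier → StdV n} {x₀ : S.carrier}
    (h : v x₀ ∈ flag n (S.weight x₀).val) : mkTensor S v = 0 :=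
  (PiTensorProduct.tprod ℂ).map_coord_zero x₀ (quotMk_eq_zero.mpr h)

/-- The index set of the monomial basis of `T_S`. -/
abbrev MonomialIndex (S : USet n) : Type :=
  ∀ x : S.carrier, {p : Fin n × ℕ // (S.weight x).val ≤ p.1.val}

/-- The basis of `T_S` formed by the tensors of basis vectors of the `𝐕 / 𝐕_m`. -/
def monomialBasis (S : USet n) :
    Module.Basis (MonomialIndex S) ℂ (⨂[ℂ] x : S.carrier, QuotV n (S.weight x).val) :=
  Basis.piTensorProduct fun x => quotBasis n (S.weight x).val

lemma monomialBasis_apply (q : MonomialIndex S) :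
    monomialBasis S q = mkTensor S fun x => stdE n (q x) := by
  rw [monomialBasis, Basis.piTensorProduct_apply]
  simp only [quotBasis_apply]
  rfl

lemma monomialBasis_repr_mkTensor [Fintype S.carrier] (v : S.carrier → StdV n)
    (q : MonomialIndex S) :
    (monomialBasis S).repr (mkTensor S v) q = ∏ x, (stdE n).repr (v x) (q x) :=
  (Basis.piTensorProduct_repr_tprod_apply _ _ _).trans <|
    Finset.prod_congr rfl fun _ _ => quotBasis_repr_quotMk _ _

lemma tRep_elementary_mkTensor [DecidableEq S.carrier] {p p' : Fin n × ℕ} (h : p'.1 ≤ p.1)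
    {v : S.carrier → StdV n} {x₀ : S.carrier} (hv : ∀ x ≠ x₀, (stdE n).coord p (v x) = 0) :
    tRep S (elementary h) (mkTensor S v) = mkTensor S v +
      (stdE n).coord p (v x₀) • mkTensor S (Function.update v x₀ (stdE n p')) := by
  rw [tRep_mkTensor]
  simp only [stdRep_elementary]
  exact map_add_smul_of_forall_ne_eq_zero (mkTensor S) _ _ v x₀ hv

lemma tRep_elementary_self_monomialBasis [Fintype S.carrier] (p : Fin n × ℕ) (q : MonomialIndex S) :
    tRep S (elementary (le_refl p.1)) (monomialBasis S q) =
      (2 ^ (Finset.univ.filter fun x => (q x).1 = p).card : ℂ) • monomialBasis S q := by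
  rw [monomialBasis_apply, tRep_mkTensor]
  have scaled (r : Fin n × ℕ) : stdRep n (elementary (le_refl p.1)) (stdE n r) =
      (if r = p then 2 else 1 : ℂ) • stdE n r := by
    rw [stdRep_elementary]
    obtain rfl | hr := eq_or_ne r p
    · rw [coord_basis_self, if_pos rfl, one_smul, two_smul]
    · rw [coord_basis_of_ne _ hr, if_neg hr, zero_smul, add_zero, one_smul]
  simp only [scaled]
  rw [(mkTensor S).map_smul_univ, Finset.prod_ite, Finset.prod_const, Finset.prod_const_one,
    mul_one]

lemma monomialBasis_repr_tRep_elementary_self [Fintype S.carrier] (p : Fin n × ℕ)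
    (u : ⨂[ℂ] x : S.carrier, QuotV n (S.weight x).val) (q : MonomialIndex S) :
    (monomialBasis S).repr (tRep S (elementary (le_refl p.1)) u) q =
      2 ^ (Finset.univ.filter fun x => (q x).1 = p).card * (monomialBasis S).repr u q :=
  repr_apply_of_forall_eq_smul _ (tRep_elementary_self_monomialBasis p) u q

lemma monomialBasis_repr_tRep_elementary [DecidableEq S.carrier] {p p' : Fin n × ℕ}
    (h : p'.1 ≤ p.1) {q : MonomialIndex S} {x₀ : S.carrier} (hq₀ : (q x₀).1 = p')
    (hq : ∀ x ≠ x₀, (q x).1 ≠ p') (hp : (S.weight x₀).val ≤ p.1.val)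
    (u : ⨂[ℂ] x : S.carrier, QuotV n (S.weight x).val) :
    (monomialBasis S).repr (tRep S (elementary h) u) q =
      (monomialBasis S).repr u q + (monomialBasis S).repr u (Function.update q x₀ ⟨p, hp⟩) := by
  suffices (monomialBasis S).coord q ∘ₗ tRep S (elementary h) = (monomialBasis S).coord q +
      (monomialBasis S).coord (Function.update q x₀ ⟨p, hp⟩) from
    LinearMap.congr_fun this u
  have := Fintype.ofFinite S.carrier
  refine linearMap_ext_mkTensor fun v => ?_
  have acted : ∏ x ∈ {x₀}ᶜ, (stdE n).repr (stdRep n (elementary h) (v x)) (q x) =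
      ∏ x ∈ {x₀}ᶜ, (stdE n).repr (v x) (q x) := Finset.prod_congr rfl fun x hx => by
    rw [stdRep_elementary, map_add, map_smul, Module.Basis.repr_self, Finsupp.add_apply,
      Finsupp.smul_apply, Finsupp.single_eq_of_ne (hq x (by simpa using hx)), smul_zero, add_zero]
  have updated : ∏ x ∈ {x₀}ᶜ, (stdE n).repr (v x)
        (Function.update q x₀ ⟨p, hp⟩ x) =
      ∏ x ∈ {x₀}ᶜ, (stdE n).repr (v x) (q x) := Finset.prod_congr rfl fun x hx => by
    rw [Function.update_of_ne (by simpa using hx)]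
  simp only [LinearMap.comp_apply, LinearMap.add_apply, Module.Basis.coord_apply, tRep_mkTensor,
    monomialBasis_repr_mkTensor, Fintype.prod_eq_mul_prod_compl x₀, Function.update_self]
  rw [acted, updated, stdRep_elementary, hq₀, map_add, map_smul, Module.Basis.repr_self,
    Finsupp.add_apply, Finsupp.smul_apply, Finsupp.single_eq_same, smul_eq_mul, mul_one, add_mul]
  rfl

end Tensor

/-! ### A cyclic vector of `T_S` -/

lemma nonempty_embedding_nat (α : Type*) [Finite α] : Nonempty (α ↪ ℕ) :=
  ⟨(Finite.equivFin α).toEmbedding.trans Fin.valEmbedding⟩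

section Cyclic

variable {n : ℕ} {S : USet n}

lemma mkTensor_update_mem [DecidableEq S.carrier]
    {W : Submodule ℂ (⨂[ℂ] x : S.carrier, QuotV n (S.weight x).val)}
    (hW : ∀ g, ∀ v ∈ W, tRep S g v ∈ W) {q : S.carrier → Fin n × ℕ}
    (hqW : mkTensor S (stdE n ∘ q) ∈ W) {x₀ : S.carrier} {p : Fin n × ℕ} (hp : p.1 ≤ (q x₀).1)
    (hq : ∀ x ≠ x₀, q x ≠ q x₀) :
    mkTensor S (stdE n ∘ Function.update q x₀ p) ∈ W := by
  have moved := tRep_elementary_mkTensor hp (v := stdE n ∘ q) (x₀ := x₀) fun x hx =>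
    coord_basis_of_ne (stdE n) (hq x hx)
  rw [Function.comp_apply, coord_basis_self, one_smul, ← Function.comp_update] at moved
  have h := W.sub_mem (hW (elementary hp) _ hqW) hqW
  rwa [moved, add_sub_cancel_left] at h

variable [NeZero n]

/-- The index of the monomial `⨂ e_{n, j x}`, all of whose factors lie in the last block. -/
def topIndex (S : USet n) (j : S.carrier ↪ ℕ) : MonomialIndex S :=
  fun x => ⟨(⊤, j x), Fin.le_def.mp le_top⟩

/-- The vector `⨂ e_{n, j x}`; it generates `T_S` because `𝐆` moves `e_{n, j}` to any other vector
of `𝐕`. -/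
def topMonomial (S : USet n) (j : S.carrier ↪ ℕ) : ⨂[ℂ] x : S.carrier, QuotV n (S.weight x).val :=
  monomialBasis S (topIndex S j)

lemma topMonomial_eq_mkTensor (j : S.carrier ↪ ℕ) :
    topMonomial S j = mkTensor S fun x => stdE n (⊤, j x) :=
  monomialBasis_apply _

lemma mkTensor_mem_of_disjoint
    {W : Submodule ℂ (⨂[ℂ] x : S.carrier, QuotV n (S.weight x).val)}
    (hW : ∀ g, ∀ v ∈ W, tRep S g v ∈ W) {j : S.carrier ↪ ℕ} (hjW : topMonomial S j ∈ W)
    {q : S.carrier → Fin n × ℕ} (hq : ∀ x x', q x ≠ (⊤, j x')) :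
    mkTensor S (stdE n ∘ q) ∈ W := by
  classical
  have := Fintype.ofFinite S.carrier
  suffices ∀ A : Finset S.carrier,
      mkTensor S (stdE n ∘ A.piecewise q fun x => (⊤, j x)) ∈ W by
    simpa only [Finset.piecewise_univ] using this Finset.univ
  intro A
  induction A using Finset.induction_on with
  | empty =>
    rw [Finset.piecewise_empty]
    exact topMonomial_eq_mkTensor j ▸ hjW
  | insert x₀ A hx₀ ih =>
    rw [Finset.piecewise_insert]
    have at_x₀ : A.piecewise q (fun x => (⊤, j x)) x₀ = (⊤, j x₀) :=
      Finset.piecewise_eq_of_notMem _ _ _ hx₀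
    refine mkTensor_update_mem hW ih (at_x₀ ▸ le_top) fun x hx => ?_
    rw [at_x₀]
    by_cases hxA : x ∈ A
    · rw [Finset.piecewise_eq_of_mem _ _ _ hxA]
      exact hq x x₀
    · rw [Finset.piecewise_eq_of_notMem _ _ _ hxA]
      exact fun h => hx (j.injective (congrArg Prod.snd h))

/-- Shifting `j` past all second indices in sight makes the two replacements possible whatever the
target monomial is. -/
lemma eq_top_of_topMonomial_mem
    {W : Submodule ℂ (⨂[ℂ] x : S.carrier, QuotV n (S.weight x).val)}
    (hW : ∀ g, ∀ v ∈ W, tRep S g v ∈ W) {j : S.carrier ↪ ℕ} (hjW : topMonomial S j ∈ W) :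
    W = ⊤ := by
  have := Fintype.ofFinite S.carrier
  rw [eq_top_iff, ← (monomialBasis S).span_eq, Submodule.span_le]
  rintro _ ⟨q, rfl⟩
  obtain ⟨M, hM⟩ := (Set.finite_range fun x => max (j x) (q x).1.2).bddAbove
  replace hM (x) : max (j x) (q x).1.2 ≤ M := hM ⟨x, rfl⟩
  let j' : S.carrier ↪ ℕ := j.trans (addLeftEmbedding (M + 1))
  have hj' : topMonomial S j' ∈ W := by
    rw [topMonomial_eq_mkTensor]
    refine mkTensor_mem_of_disjoint hW hjW fun x x' h => ?_
    have : M + 1 + j x = j x' := congrArg Prod.snd h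
    have := hM x'
    omega
  rw [SetLike.mem_coe, monomialBasis_apply]
  refine mkTensor_mem_of_disjoint hW hj' fun x x' h => ?_
  have : (q x).1.2 = M + 1 + j x' := congrArg Prod.snd h
  have := hM x
  omega

lemma intertwiningMap_ext_topMonomial {N : Type} [AddCommGroup N] [Module ℂ N]
    {σ : Representation ℂ (Gpar n) N} (j : S.carrier ↪ ℕ) {F F' : (tRep S).IntertwiningMap σ}
    (h : F (topMonomial S j) = F' (topMonomial S j)) : F = F' := by
  apply Representation.IntertwiningMap.toLinearMap_injective
  rw [← LinearMap.eqLocus_eq_top]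
  refine eq_top_of_topMonomial_mem (fun g v hv => ?_) h
  change F (tRep S g v) = F' (tRep S g v)
  rw [F.isIntertwining, F'.isIntertwining]
  exact congrArg _ hv

end Cyclic

/-! ### Equivariant maps on the cyclic vector -/

section Image

variable {n : ℕ} {S T : USet n}

lemma card_filter_eq_of_repr_ne_zero [Fintype S.carrier] [Fintype T.carrier]
    (F : (tRep S).IntertwiningMap (tRep T)) {s : MonomialIndex S} {q : MonomialIndex T}
    (hq : (monomialBasis T).repr (F (monomialBasis S s)) q ≠ 0) (p : Fin n × ℕ) :
    (Finset.univ.filter fun x => (s x).1 = p).card =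
      (Finset.univ.filter fun y => (q y).1 = p).card := by
  have h := monomialBasis_repr_tRep_elementary_self p (F (monomialBasis S s)) q
  rw [← F.isIntertwining, tRep_elementary_self_monomialBasis, map_smul, map_smul,
    Finsupp.smul_apply, smul_eq_mul] at h
  exact Nat.pow_right_injective le_rfl (by exact_mod_cast mul_right_cancel₀ hq h)

lemma exists_equiv_of_repr_ne_zero (F : (tRep S).IntertwiningMap (tRep T)) {s : MonomialIndex S}
    {q : MonomialIndex T} (hq : (monomialBasis T).repr (F (monomialBasis S s)) q ≠ 0) :
    ∃ e : S.carrier ≃ T.carrier, ∀ x, (q (e x)).1 = (s x).1 := by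
  have := Fintype.ofFinite S.carrier
  have := Fintype.ofFinite T.carrier
  refine exists_equiv_comp_eq_of_card_fiber_eq (f := fun x => (s x).1) (g := fun y => (q y).1)
    fun p => ?_
  simp only [Nat.card_eq_fintype_card, Fintype.card_subtype]
  exact card_filter_eq_of_repr_ne_zero F hq p

variable [NeZero n]

lemma tRep_elementary_topMonomial {j : S.carrier ↪ ℕ} {x₀ : S.carrier} {p : Fin n × ℕ}
    (h : p.1 ≤ ((⊤, j x₀) : Fin n × ℕ).1) (hp : p.1 < S.weight x₀) :
    tRep S (elementary h) (topMonomial S j) = topMonomial S j := by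
  classical
  have killed : mkTensor S (Function.update (fun x => stdE n (⊤, j x)) x₀ (stdE n p)) = 0 :=
    mkTensor_eq_zero (x₀ := x₀) <| by
      rw [Function.update_self]
      exact Submodule.subset_span ⟨p, hp, rfl⟩
  rw [topMonomial_eq_mkTensor, tRep_elementary_mkTensor h (x₀ := x₀) fun x hx =>
    coord_basis_of_ne _ fun hxx₀ => hx (j.injective (congrArg Prod.snd hxx₀)),
    killed, smul_zero, add_zero]

/-- If the weight dropped at `x₀`, the element of `𝐆` adding `e_{i,0}` to `e_{n, j x₀}`, for `i` the
weight of `e x₀`, would fix the cyclic vector but not its image. -/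
lemma weight_le_of_repr_ne_zero {j : S.carrier ↪ ℕ} (F : (tRep S).IntertwiningMap (tRep T))
    {q : MonomialIndex T} (hq : (monomialBasis T).repr (F (topMonomial S j)) q ≠ 0)
    {e : S.carrier ≃ T.carrier} (he : ∀ x, (q (e x)).1 = (⊤, j x)) (x₀ : S.carrier) :
    S.weight x₀ ≤ T.weight (e x₀) := by
  classical
  by_contra! hlt
  let p : Fin n × ℕ := (T.weight (e x₀), 0)
  have hp : p.1 ≤ ((⊤, j x₀) : Fin n × ℕ).1 := le_top
  have ne_p (y) (hy : y ≠ e x₀) : (Function.update q (e x₀) ⟨p, le_rfl⟩ y).1 ≠ p := fun h => by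
    rw [Function.update_of_ne hy, ← e.apply_symm_apply y, he] at h
    exact (hlt.trans_le le_top).ne' (congrArg Prod.fst h)
  have q_eq : Function.update q (e x₀) ⟨(⊤, j x₀), Fin.le_def.mp le_top⟩ = q :=
    Function.update_eq_self_iff.mpr (Subtype.ext (he x₀).symm)
  have h := monomialBasis_repr_tRep_elementary hp (x₀ := e x₀)
    (congrArg Subtype.val (Function.update_self (e x₀) _ q)) ne_p (Fin.le_def.mp le_top)
    (F (topMonomial S j))
  rw [← F.isIntertwining, tRep_elementary_topMonomial hp hlt, left_eq_add,
    Function.update_idem, q_eq] at h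
  exact hq h

lemma tMap_topMonomial (j : S.carrier ↪ ℕ) (f : S ⟶ T) :
    tMap f (topMonomial S j) = topMonomial T (f.toEquiv.symm.toEmbedding.trans j) := by
  rw [topMonomial_eq_mkTensor, topMonomial_eq_mkTensor, tMap_mkTensor]
  rfl

lemma linearIndependent_tMap_topMonomial (j : S.carrier ↪ ℕ) :
    LinearIndependent ℂ fun f : S ⟶ T => tMap f (topMonomial S j) := by
  simp only [tMap_topMonomial]
  refine (monomialBasis T).linearIndependent.comp
    (fun f : S ⟶ T => topIndex T (f.toEquiv.symm.toEmbedding.trans j)) fun f g h => ?_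
  have symm_eq : f.toEquiv.symm = g.toEquiv.symm := Equiv.ext fun y =>
    j.injective (congrArg (fun q : MonomialIndex T => (q y).1.2) h)
  exact UHom.ext (Equiv.symm_bijective.injective symm_eq)

lemma intertwiningMap_topMonomial_mem_span (j : S.carrier ↪ ℕ)
    (F : (tRep S).IntertwiningMap (tRep T)) :
    F (topMonomial S j) ∈
      Submodule.span ℂ (Set.range fun f : S ⟶ T => tMap f (topMonomial S j)) := by
  rw [← (monomialBasis T).linearCombination_repr (F (topMonomial S j))]
  refine Submodule.sum_mem _ fun q hq => Submodule.smul_mem _ _ (Submodule.subset_span ?_)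
  replace hq := Finsupp.mem_support_iff.mp hq
  obtain ⟨e, he⟩ := exists_equiv_of_repr_ne_zero F hq
  let f : S ⟶ T := ⟨e, weight_le_of_repr_ne_zero F hq he⟩
  have q_eq : q = topIndex T (f.toEquiv.symm.toEmbedding.trans j) := by
    funext y
    obtain ⟨x, rfl⟩ := e.surjective y
    refine Subtype.ext ((he x).trans (congrArg (fun x => (⊤, j x)) ?_))
    exact (e.symm_apply_apply x).symm
  exact ⟨f, (tMap_topMonomial j f).trans (congrArg (monomialBasis T) q_eq.symm)⟩

end Image

/-! ### `Hom_𝐆(T_S, T_T)` -/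

/-- The value of an equivariant map at a vector, as a linear function of the map. -/
def evalAt {G : Type} [Group G] {A B : Rep.{0} ℂ G} (v : A) : (A ⟶ B) →ₗ[ℂ] B where
  toFun F := F.hom v
  map_add' _ _ := rfl
  map_smul' _ _ := rfl

section HomBasis

variable {n : ℕ} [NeZero n]

lemma linearIndependent_TFunctor_map (S T : USet n) :
    LinearIndependent ℂ fun f : S ⟶ T => (TFunctor n).map f := by
  obtain ⟨j⟩ := nonempty_embedding_nat S.carrier
  exact .of_comp (evalAt (A := (TFunctor n).obj S) (topMonomial S j))
    (linearIndependent_tMap_topMonomial j)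

lemma mem_span_TFunctor_map {S T : USet n} (F : (TFunctor n).obj S ⟶ (TFunctor n).obj T) :
    F ∈ Submodule.span ℂ (Set.range fun f : S ⟶ T => (TFunctor n).map f) := by
  obtain ⟨j⟩ := nonempty_embedding_nat S.carrier
  obtain ⟨c, hc⟩ := Finsupp.mem_span_range_iff_exists_finsupp.mp
    (intertwiningMap_topMonomial_mem_span j F.hom)
  refine Finsupp.mem_span_range_iff_exists_finsupp.mpr
    ⟨c, Rep.hom_ext (intertwiningMap_ext_topMonomial j (Eq.trans ?_ hc))⟩
  exact Finsupp.apply_linearCombination ℂ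
    (evalAt (A := (TFunctor n).obj S) (B := (TFunctor n).obj T) (topMonomial S j)) _ c

/-- The basis of `Hom_𝐆(T_S, T_T)` formed by the maps induced by the morphisms `S ⟶ T`. -/
def homBasis (S T : USet n) : Module.Basis (S ⟶ T) ℂ ((TFunctor n).obj S ⟶ (TFunctor n).obj T) :=
  .mk (linearIndependent_TFunctor_map S T) fun F _ => mem_span_TFunctor_map F

lemma homBasis_apply {S T : USet n} (f : S ⟶ T) : homBasis S T f = (TFunctor n).map f :=
  Module.Basis.mk_apply (linearIndependent_TFunctor_map S T) (fun F _ => mem_span_TFunctor_map F) f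

lemma nontrivial_hom_iff {S T : USet n} :
    Nontrivial ((TFunctor n).obj S ⟶ (TFunctor n).obj T) ↔ Nonempty (S ⟶ T) := by
  refine ⟨fun _ => (homBasis S T).index_nonempty, fun ⟨f⟩ => ?_⟩
  exact nontrivial_of_ne _ 0 ((homBasis S T).ne_zero f)

lemma finrank_hom (S T : USet n) :
    Module.finrank ℂ ((TFunctor n).obj S ⟶ (TFunctor n).obj T) = Nat.card (S ⟶ T) :=
  Module.finrank_eq_nat_card_basis (homBasis S T)

/-- The isomorphism `P_S ≅ Hom_𝐆(T_S, -)`. -/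
def princProjIso (S : USet n) : princProj S ≅ homT S :=
  NatIso.ofComponents (fun T => (homBasis S T).repr.symm.toModuleIso) fun {T T'} f => by
    ext : 1
    refine Finsupp.lhom_ext' fun φ => LinearMap.ext_ring ?_
    change (homBasis S T').repr.symm (Finsupp.mapDomain (· ≫ f) (Finsupp.single φ 1)) =
      (homBasis S T).repr.symm (Finsupp.single φ 1) ≫ (TFunctor n).map f
    rw [Finsupp.mapDomain_single, Module.Basis.repr_symm_single_one,
      Module.Basis.repr_symm_single_one, homBasis_apply, homBasis_apply, Functor.map_comp]

lemma princProjIso_hom_app_single {S T : USet n} (φ : S ⟶ T) :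
    ((princProjIso S).hom.app T).hom (Finsupp.single φ 1) = (TFunctor n).map φ :=
  ((homBasis S T).repr_symm_single_one φ).trans (homBasis_apply φ)

end HomBasis

section Finiteness

variable {n : ℕ}

instance (S T : USet n) : Finite (S ⟶ T) :=
  Finite.of_injective UHom.toEquiv fun _ _ => UHom.ext

instance (S T : DSet n) : Finite (S ⟶ T) :=
  Finite.of_injective DHom.toEquiv fun _ _ => DHom.ext

lemma isIso_of_weight_eq {S T : USet n} (f : S ⟶ T)
    (h : ∀ x, S.weight x = T.weight (f.toEquiv x)) : IsIso f :=
  ⟨⟨f.toEquiv.symm, fun y => by rw [h, Equiv.apply_symm_apply]⟩,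
    UHom.ext f.toEquiv.self_trans_symm, UHom.ext f.toEquiv.symm_trans_self⟩

lemma weight_eq_of_isIso {S T : USet n} (f : S ⟶ T) [IsIso f] (x : S.carrier) :
    S.weight x = T.weight (f.toEquiv x) := by
  refine le_antisymm (f.weight_le x) ?_
  have inv_apply : (inv f).toEquiv (f.toEquiv x) = x :=
    congrArg (fun g : S ⟶ S => g.toEquiv x) (IsIso.hom_inv_id f)
  exact ((inv f).weight_le (f.toEquiv x)).trans_eq (congrArg S.weight inv_apply)

lemma isFiniteModule_homT [NeZero n] (S : USet n) : IsFiniteModule (homT S) where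
  finite_obj T := Module.Finite.of_basis (homBasis S T)
  finite_support := by
    refine ⟨Set.range fun w : S.carrier → Fin n => { carrier := S.carrier, weight := w },
      Set.finite_range _, fun T hT => ?_⟩
    obtain ⟨f⟩ := nontrivial_hom_iff.mp hT
    let S' : USet n := { carrier := S.carrier, weight := fun x => T.weight (f.toEquiv x) }
    let f' : S' ⟶ T := ⟨f.toEquiv, fun _ => le_rfl⟩
    have : IsIso f' := isIso_of_weight_eq f' fun _ => rfl
    exact ⟨S', ⟨_, rfl⟩, ⟨(asIso f').symm⟩⟩

end Finiteness

/-! ### `P_S` is dual to `J_S` -/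

section Duality

variable {n : ℕ}

/-- The bijection `Hom_𝒰(S, T) ≃ Hom_𝒟(T, S)` underlying the identification of `𝒟` with `𝒰ᵒᵖ`. -/
def invEquiv (S T : USet n) : (S ⟶ T) ≃ (T.toD ⟶ S.toD) where
  toFun := UHom.inv
  invFun g := ⟨g.toEquiv.symm, fun x =>
    (congrArg S.weight (g.toEquiv.apply_symm_apply x)).symm.le.trans
      (g.weight_le (g.toEquiv.symm x))⟩
  left_inv _ := rfl
  right_inv _ := rfl

/-- The isomorphism `P_S ≅ (J_S)^∨`: a finite dimensional space is its own double dual. -/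
def princProjIsoDual (S : USet n) : princProj S ≅ dualOfD (princInj S.toD) :=
  NatIso.ofComponents (fun T => ((Finsupp.domLCongr (invEquiv S T)).trans
    (Module.evalEquiv ℂ ((T.toD ⟶ S.toD) →₀ ℂ))).toModuleIso) fun {T T'} f => by
    ext : 1
    refine Finsupp.lhom_ext' fun φ => LinearMap.ext_ring <|
      LinearMap.ext fun ξ : Module.Dual ℂ ((T'.toD ⟶ S.toD) →₀ ℂ) => ?_
    change ξ (Finsupp.domLCongr (invEquiv S T')
        (Finsupp.mapDomain (· ≫ f) (Finsupp.single φ 1))) =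
      ξ (Finsupp.mapDomain (UHom.inv f ≫ ·)
        (Finsupp.domLCongr (invEquiv S T) (Finsupp.single φ 1)))
    rw [Finsupp.mapDomain_single, Finsupp.domLCongr_single, Finsupp.domLCongr_single,
      Finsupp.mapDomain_single]
    rfl

lemma princProjIsoDual_hom_app_single {S T : USet n} (φ : S ⟶ T) :
    ((princProjIsoDual S).hom.app T).hom (Finsupp.single φ 1) =
      Module.Dual.eval ℂ ((T.toD ⟶ S.toD) →₀ ℂ) (Finsupp.single (UHom.inv φ) 1) :=
  congrArg (Module.Dual.eval ℂ ((T.toD ⟶ S.toD) →₀ ℂ))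
    (Finsupp.domLCongr_single (invEquiv S T) φ 1)

end Duality

/-! ### Counting the morphisms of `𝒰` -/

section Counting

variable {X : Type*} [DecidableEq X]

lemma snoc_mem_filter_injective_piFinset {m : ℕ} {N : Fin (m + 1) → Finset X} {f : Fin m → X}
    {x : X} :
    (Fin.snoc f x : Fin (m + 1) → X) ∈ (Fintype.piFinset N).filter Function.Injective ↔
      f ∈ (Fintype.piFinset fun k => N k.castSucc).filter Function.Injective ∧
        x ∈ N (Fin.last m) \ Finset.univ.image f := by
  simp only [Finset.mem_filter, Fintype.mem_piFinset, Fin.forall_fin_succ', Fin.snoc_castSucc,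
    Fin.snoc_last, Fin.snoc_injective_iff, Finset.mem_sdiff, Finset.mem_image, Finset.mem_univ,
    true_and, Set.mem_range]
  tauto

lemma card_filter_injective_piFinset {m : ℕ} {N : Fin m → Finset X} (hN : Monotone N) :
    ((Fintype.piFinset N).filter Function.Injective).card = ∏ k, ((N k).card - k) := by
  induction m with
  | zero => simp [Function.injective_of_subsingleton]
  | succ m ih =>
    let A := (Fintype.piFinset fun k : Fin m => N k.castSucc).filter Function.Injective
    have snoc_bij : ((Fintype.piFinset N).filter Function.Injective).card =
        (A.sigma fun f => N (Fin.last m) \ Finset.univ.image f).card := by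
      refine Finset.card_nbij' (fun f => ⟨Fin.init f, f (Fin.last m)⟩) (fun p => Fin.snoc p.1 p.2)
        (fun f hf => ?_) (fun p hp => ?_) (fun f _ => Fin.snoc_init_self f) fun p _ => ?_
      · rw [← Fin.snoc_init_self f] at hf
        exact Finset.mem_sigma.mpr (snoc_mem_filter_injective_piFinset.mp hf)
      · exact snoc_mem_filter_injective_piFinset.mpr (Finset.mem_sigma.mp hp)
      · simp only [Fin.init_snoc, Fin.snoc_last, Sigma.eta]
    have card_fiber (f) (hf : f ∈ A) :
        (N (Fin.last m) \ Finset.univ.image f).card = (N (Fin.last m)).card - m := by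
      obtain ⟨hfN, hf⟩ := Finset.mem_filter.mp hf
      rw [Finset.card_sdiff_of_subset, Finset.card_image_of_injective _ hf, Finset.card_univ,
        Fintype.card_fin]
      refine Finset.image_subset_iff.mpr fun k _ => hN (Fin.le_last k.castSucc) ?_
      exact Fintype.mem_piFinset.mp hfN k
    rw [snoc_bij, Finset.card_sigma, Finset.sum_congr rfl card_fiber, Finset.sum_const, smul_eq_mul,
      ih fun _ _ h => hN (Fin.castSucc_le_castSucc_iff.mpr h), Fin.prod_univ_castSucc]
    rfl

lemma coe_finSigmaFinEquiv {n : ℕ} {b : Fin n → ℕ} (y : Σ i, Fin (b i)) :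
    (finSigmaFinEquiv y : ℕ) = ∑ j ∈ Finset.Iio y.1, b j + y.2 := by
  rw [finSigmaFinEquiv_apply]
  congr 1
  refine Finset.sum_nbij (Fin.castLE y.1.2.le) (fun j _ => ?_) ?_ (fun j hj => ?_) fun _ _ => rfl
  · exact Finset.mem_Iio.mpr (Fin.lt_def.mpr j.2)
  · exact (Fin.castLE_injective _).injOn
  · exact ⟨⟨j, Fin.lt_def.mp (Finset.mem_Iio.mp hj)⟩, Finset.mem_coe.mpr (Finset.mem_univ _), rfl⟩

lemma sum_Iic_eq {n : ℕ} (b : Fin n → ℕ) (i : Fin n) :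
    ∑ j ∈ Finset.Iic i, b j = ∑ j ∈ Finset.Iio i, b j + b i := by
  rw [← Finset.Iio_insert, Finset.sum_insert Finset.notMem_Iio_self, add_comm]

lemma fst_finSigmaFinEquiv_symm_monotone {n : ℕ} (b : Fin n → ℕ) :
    Monotone fun k => ((finSigmaFinEquiv (n := b)).symm k).1 := by
  intro k l hkl
  obtain ⟨y, rfl⟩ := finSigmaFinEquiv.surjective k
  obtain ⟨z, rfl⟩ := finSigmaFinEquiv.surjective l
  simp only [Equiv.symm_apply_apply]
  by_contra! hzy
  rw [Fin.le_def, coe_finSigmaFinEquiv, coe_finSigmaFinEquiv] at hkl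
  have block_le : ∑ j ∈ Finset.Iic z.1, b j ≤ ∑ j ∈ Finset.Iio y.1, b j :=
    Finset.sum_le_sum_of_subset fun j hj =>
      Finset.mem_Iio.mpr ((Finset.mem_Iic.mp hj).trans_lt hzy)
  rw [sum_Iic_eq] at block_le
  have := z.2.2
  omega

lemma card_filter_injective_piFinset_sigma {n : ℕ} {N : Fin n → Finset X} (hN : Monotone N)
    (b : Fin n → ℕ) :
    ((Fintype.piFinset fun y : Σ i, Fin (b i) => N y.1).filter Function.Injective).card =
      ∏ i, ((N i).card - ∑ j ∈ Finset.Iio i, b j).descFactorial (b i) := by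
  calc
    _ = ((Fintype.piFinset fun k => N ((finSigmaFinEquiv (n := b)).symm k).1).filter
          Function.Injective).card := by
      refine Finset.card_equiv (finSigmaFinEquiv.arrowCongr (Equiv.refl X)) fun f => ?_
      rw [Finset.mem_filter, Finset.mem_filter, Fintype.mem_piFinset, Fintype.mem_piFinset]
      exact and_congr (Equiv.forall_congr_left finSigmaFinEquiv)
        (Equiv.injective_comp finSigmaFinEquiv.symm f).symm
    _ = ∏ k, ((N ((finSigmaFinEquiv (n := b)).symm k).1).card - k) :=
      card_filter_injective_piFinset (hN.comp (fst_finSigmaFinEquiv_symm_monotone b))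
    _ = ∏ y : Σ i, Fin (b i), ((N y.1).card - finSigmaFinEquiv y) := by
      rw [← Equiv.prod_comp finSigmaFinEquiv]
      simp only [Equiv.symm_apply_apply]
    _ = ∏ i, ∏ k : Fin (b i), ((N i).card - ∑ j ∈ Finset.Iio i, b j - k) := by
      simp only [coe_finSigmaFinEquiv, ← Nat.sub_sub, ← Finset.univ_sigma_univ, Finset.prod_sigma]
    _ = _ := by
      simp only [Nat.descFactorial_eq_prod_range, Finset.prod_range]

end Counting

section CountingHom

variable {n : ℕ}

lemma card_filter_fst_le (a : Fin n → ℕ) (i : Fin n) :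
    (Finset.univ.filter fun x : Σ i, Fin (a i) => x.1 ≤ i).card = ∑ j ∈ Finset.Iic i, a j := by
  have : (Finset.univ.filter fun x : Σ i, Fin (a i) => x.1 ≤ i) =
      (Finset.Iic i).sigma fun _ => Finset.univ := by
    ext x
    simp only [Finset.mem_filter, Finset.mem_univ, true_and, Finset.mem_sigma, Finset.mem_Iic,
      and_true]
  simp only [this, Finset.card_sigma, Finset.card_univ, Fintype.card_fin]

variable {a b : Fin n → ℕ}

lemma sum_eq_of_hom (f : USet.ofTuple a ⟶ USet.ofTuple b) : ∑ i, a i = ∑ i, b i := by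
  simpa only [Fintype.card_sigma, Fintype.card_fin] using
    Fintype.card_congr (α := Σ i, Fin (a i)) (β := Σ i, Fin (b i)) f.toEquiv

lemma dominates_of_hom (f : USet.ofTuple a ⟶ USet.ofTuple b) : Dominates a b := by
  intro i
  rw [← card_filter_fst_le, ← card_filter_fst_le]
  refine Finset.card_le_card_of_injOn f.toEquiv.symm (fun y hy => ?_) f.toEquiv.symm.injective.injOn
  have hy : y.1 ≤ i := (Finset.mem_filter.mp hy).2
  exact Finset.mem_filter.mpr
    ⟨Finset.mem_univ _, (Fin.le_def.mpr (weight_symm_le f y)).trans hy⟩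

/-- The morphisms `a ⟶ b` of `𝒰` as the injections `b → a` along which weights do not increase:
between sets of the same size an injection is a bijection. -/
def homEquivInjective (h : ∑ i, a i = ∑ i, b i) : (USet.ofTuple a ⟶ USet.ofTuple b) ≃
    {g : (Σ i, Fin (b i)) → Σ i, Fin (a i) // (∀ y, (g y).1 ≤ y.1) ∧ Function.Injective g} where
  toFun f := ⟨f.toEquiv.symm, weight_symm_le f, f.toEquiv.symm.injective⟩
  invFun g :=
    let e := Equiv.ofBijective g.1
      ((Fintype.bijective_iff_injective_and_card g.1).mpr ⟨g.2.2, by simp [h]⟩)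
    ⟨e.symm, fun x => (congrArg Sigma.fst (e.apply_symm_apply x)).symm.le.trans (g.2.1 (e.symm x))⟩
  left_inv f := UHom.ext (Equiv.symm_bijective.injective (Equiv.ext fun _ => rfl))
  right_inv _ := rfl

lemma card_hom (h : ∑ i, a i = ∑ i, b i) :
    Nat.card (USet.ofTuple a ⟶ USet.ofTuple b) =
      ∏ i, ((∑ j ∈ Finset.Iic i, a j) - ∑ j ∈ Finset.Iio i, b j).descFactorial (b i) := by
  let N (i : Fin n) : Finset (Σ i, Fin (a i)) := Finset.univ.filter fun x => x.1 ≤ i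
  have hN : Monotone N := fun i j hij x hx =>
    Finset.mem_filter.mpr ⟨Finset.mem_univ x, (Finset.mem_filter.mp hx).2.trans hij⟩
  simp only [← card_filter_fst_le]
  rw [← card_filter_injective_piFinset_sigma hN b, Nat.card_congr (homEquivInjective h),
    Nat.card_eq_fintype_card, Fintype.card_subtype]
  congr 1
  ext g
  simp only [N, Finset.mem_filter, Finset.mem_univ, true_and, Fintype.mem_piFinset]

lemma nonempty_hom_iff :
    Nonempty (USet.ofTuple a ⟶ USet.ofTuple b) ↔ ∑ i, a i = ∑ i, b i ∧ Dominates a b := by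
  refine ⟨fun ⟨f⟩ => ⟨sum_eq_of_hom f, dominates_of_hom f⟩, fun ⟨h, hab⟩ => ?_⟩
  refine (Nat.card_pos_iff.mp ?_).1
  rw [card_hom h]
  refine Finset.prod_pos fun i _ => Nat.descFactorial_pos.mpr (Nat.le_sub_of_add_le' ?_)
  exact sum_Iic_eq b i ▸ hab i

/-- The last binomial coefficient is `1`, since the total sums of `a` and `b` agree. -/
lemma card_hom_eq_choose (h : ∑ i, a i = ∑ i, b i) :
    Nat.card (USet.ofTuple a ⟶ USet.ofTuple b) = (∏ i, (b i).factorial) *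
      ∏ i : Fin n with i.val + 1 < n,
        ((∑ j ∈ Finset.Iic i, a j) - ∑ j ∈ Finset.Iio i, b j).choose (b i) := by
  simp only [card_hom h, Nat.descFactorial_eq_factorial_mul_choose, Finset.prod_mul_distrib]
  rw [Finset.prod_filter_of_ne]
  intro i _ hi
  by_contra! hlast
  refine hi ?_
  have Iic_eq : Finset.Iic i = Finset.univ := Finset.eq_univ_of_forall fun j =>
    Finset.mem_Iic.mpr (Fin.le_def.mpr (by omega))
  rw [Iic_eq, h, ← Iic_eq, sum_Iic_eq, Nat.add_sub_cancel_left, Nat.choose_self]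

end CountingHom

/-! ### The kernel `K_S` -/

section Kernel

variable {n : ℕ} {S T : USet n}

/-- The quotient map `𝐕_{m+1} → 𝐕_{m+1} / 𝐕_m`. -/
def grMk (n m : ℕ) : flag n (m + 1) →ₗ[ℂ] GrV n m :=
  ((flag n m).comap (flag n (m + 1)).subtype).mkQ

lemma grMk_surjective (n m : ℕ) : Function.Surjective (grMk n m) :=
  Submodule.mkQ_surjective _

lemma grIncl_grMk {m : ℕ} (v : flag n (m + 1)) :
    (grIncl n m).toLinearMap (grMk n m v) = quotMk n m v := rfl

lemma grIncl_injective (n m : ℕ) : Function.Injective (grIncl n m).toLinearMap := by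
  refine (injective_iff_map_eq_zero _).mpr fun u hu => ?_
  obtain ⟨v, rfl⟩ := grMk_surjective n m u
  rw [grIncl_grMk, quotMk_eq_zero] at hu
  exact (Submodule.Quotient.mk_eq_zero _).mpr hu

/-- The linear map underlying the inclusion of `⨂ 𝐕_{(i)}` into `T_S`. -/
abbrev grTensor (S : USet n) :
    (⨂[ℂ] x : S.carrier, GrV n (S.weight x).val) →ₗ[ℂ]
      ⨂[ℂ] x : S.carrier, QuotV n (S.weight x).val :=
  (grTIncl S).hom.toLinearMap

lemma grTensor_tprod_grMk (v : ∀ x : S.carrier, flag n ((S.weight x).val + 1)) :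
    grTensor S (PiTensorProduct.tprod ℂ fun x => grMk n (S.weight x).val (v x)) =
      mkTensor S fun x => v x :=
  PiTensorProduct.map_tprod _ _

lemma grTensor_injective (S : USet n) : Function.Injective (grTensor S) :=
  piTensorProduct_map_injective fun x => grIncl_injective n (S.weight x).val

lemma not_isIso_iff_exists_weight_lt (f : S ⟶ T) :
    ¬ IsIso f ↔ ∃ x, S.weight x < T.weight (f.toEquiv x) := by
  refine ⟨fun hf => ?_, fun ⟨x, hx⟩ hf => hx.ne (weight_eq_of_isIso f x)⟩
  by_contra! hle
  exact hf (isIso_of_weight_eq f fun x => (f.weight_le x).antisymm (hle x))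

lemma tMap_mkTensor_eq_zero {f : S ⟶ T} (hf : ¬ IsIso f) {v : S.carrier → StdV n}
    (hv : ∀ x, v x ∈ flag n ((S.weight x).val + 1)) : tMap f (mkTensor S v) = 0 := by
  obtain ⟨x, hx⟩ := (not_isIso_iff_exists_weight_lt f).mp hf
  rw [tMap_mkTensor]
  refine mkTensor_eq_zero (x₀ := f.toEquiv x) (flag_mono n hx ?_)
  rw [Function.comp_apply, Equiv.symm_apply_apply]
  exact hv x

lemma tMap_comp_grTensor {f : S ⟶ T} (hf : ¬ IsIso f) : tMap f ∘ₗ grTensor S = 0 := by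
  refine PiTensorProduct.ext (MultilinearMap.ext fun u => ?_)
  choose v hv using fun x => grMk_surjective n (S.weight x).val (u x)
  obtain rfl := funext hv
  rw [LinearMap.compMultilinearMap_apply, LinearMap.compMultilinearMap_apply, LinearMap.comp_apply,
    grTensor_tprod_grMk, tMap_mkTensor_eq_zero hf fun x => (v x).2, LinearMap.zero_apply]

lemma mem_KSub {u : (TFunctor n).obj S} :
    u ∈ KSub S ↔ ∀ (T : USet n) (f : S ⟶ T), ¬ IsIso f → tMap f u = 0 := by
  simp only [KSub, Submodule.mem_iInf, LinearMap.mem_ker]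
  rfl

lemma monomialBasis_repr_tMap (f : S ⟶ T)
    (u : ⨂[ℂ] x : S.carrier, QuotV n (S.weight x).val) {q : MonomialIndex T} {r : MonomialIndex S}
    (hr : ∀ y, (r (f.toEquiv.symm y)).1 = (q y).1) :
    (monomialBasis T).repr (tMap f u) q = (monomialBasis S).repr u r := by
  have := Fintype.ofFinite S.carrier
  have := Fintype.ofFinite T.carrier
  suffices (monomialBasis T).coord q ∘ₗ tMap f = (monomialBasis S).coord r from
    LinearMap.congr_fun this u
  refine linearMap_ext_mkTensor fun v => ?_
  simp only [LinearMap.comp_apply, Module.Basis.coord_apply, tMap_mkTensor,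
    monomialBasis_repr_mkTensor, ← Equiv.prod_comp f.toEquiv.symm, hr, Function.comp_apply]

/-- A monomial with a factor outside `𝐕_{(i)}` survives in the tensor module of the set obtained
from `S` by raising the weight of that factor. -/
lemma weight_eq_of_mem_KSub {u : (TFunctor n).obj S} (hu : u ∈ KSub S) {q : MonomialIndex S}
    (hq : (monomialBasis S).repr u q ≠ 0) (x : S.carrier) : (q x).1.1 = S.weight x := by
  by_contra hne
  let T : USet n := { carrier := S.carrier, weight := fun x => (q x).1.1 }
  let f : S ⟶ T := ⟨Equiv.refl _, fun x => (q x).2⟩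
  have hf : ¬ IsIso f :=
    (not_isIso_iff_exists_weight_lt f).mpr ⟨x, lt_of_le_of_ne (q x).2 (Ne.symm hne)⟩
  refine hq ?_
  rw [← monomialBasis_repr_tMap f u (q := fun x => ⟨(q x).1, le_rfl⟩) fun _ => rfl,
    mem_KSub.mp hu T f hf, map_zero, Finsupp.zero_apply]

lemma monomialBasis_mem_range_grTensor {q : MonomialIndex S}
    (hq : ∀ x, (q x).1.1 = S.weight x) : monomialBasis S q ∈ LinearMap.range (grTensor S) := by
  have mem_flag (x) : stdE n (q x) ∈ flag n ((S.weight x).val + 1) :=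
    Submodule.subset_span ⟨_, Nat.lt_succ_of_le (Fin.le_def.mp (hq x).le), rfl⟩
  rw [monomialBasis_apply]
  exact ⟨_, grTensor_tprod_grMk fun x => ⟨stdE n (q x), mem_flag x⟩⟩

lemma range_grTensor (S : USet n) : LinearMap.range (grTensor S) = KSub S := by
  refine le_antisymm ?_ fun u hu => ?_
  · rintro _ ⟨w, rfl⟩
    exact mem_KSub.mpr fun T f hf => LinearMap.congr_fun (tMap_comp_grTensor hf) w
  · rw [← (monomialBasis S).linearCombination_repr u]
    exact Submodule.sum_mem _ fun q hq => Submodule.smul_mem _ _ <|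
      monomialBasis_mem_range_grTensor <|
        weight_eq_of_mem_KSub hu (Finsupp.mem_support_iff.mp hq)

/-- The map `⨂ 𝐕_{(i)} → K_S` through which the inclusion into `T_S` factors. -/
def grToK (S : USet n) : GrTRep S ⟶ KRep S :=
  Rep.ofHom ⟨(grTensor S).codRestrict (KSub S) fun w =>
      (range_grTensor S).le (LinearMap.mem_range_self (grTensor S) w),
    fun g => LinearMap.ext fun w => Subtype.ext (Rep.hom_comm_apply (grTIncl S) g w)⟩

lemma grToK_comp_KIncl (S : USet n) : grToK S ≫ KIncl S = grTIncl S := rfl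

lemma grToK_bijective (S : USet n) : Function.Bijective (grToK S).hom := by
  refine ⟨fun v w h => grTensor_injective S (congrArg Subtype.val h), fun ⟨u, hu⟩ => ?_⟩
  obtain ⟨w, rfl⟩ := (range_grTensor S).ge hu
  exact ⟨w, rfl⟩

instance isIso_grToK (S : USet n) : IsIso (grToK S) :=
  have : IsIso ((forget (Rep.{0} ℂ (Gpar n))).map (grToK S)) :=
    (isIso_iff_bijective _).mpr (grToK_bijective S)
  isIso_of_reflects_iso _ (forget (Rep.{0} ℂ (Gpar n)))

end Kernel

end FlagRep

end

theorem mainTheorem10 (n : ℕ) (hn : 1 ≤ n) (a : Fin n → ℕ) :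
    -- (1) `b ↦ Hom_𝐆(T_a, T_b)` is a `𝒰`-module, and is `P_a = (J_a)^∨`
    IsFiniteModule (homT (USet.ofTuple a)) ∧
    (∃ e : princProj (USet.ofTuple a) ≅ homT (USet.ofTuple a),
      ∀ (b : USet n) (φ : USet.ofTuple a ⟶ b),
        (e.hom.app b).hom (Finsupp.single φ 1) = (TFunctor n).map φ) ∧
    (∃ e : princProj (USet.ofTuple a) ≅ dualOfD (princInj (USet.ofTuple a).toD),
      ∀ (b : USet n) (φ : USet.ofTuple a ⟶ b),
        (e.hom.app b).hom (Finsupp.single φ 1) =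
          Module.Dual.eval ℂ ((b.toD ⟶ (USet.ofTuple a).toD) →₀ ℂ)
            (Finsupp.single (UHom.inv φ) 1)) ∧
    (∀ b : Fin n → ℕ,
      Nontrivial ((TFunctor n).obj (USet.ofTuple a) ⟶ (TFunctor n).obj (USet.ofTuple b)) ↔
        ∑ i, a i = ∑ i, b i ∧ Dominates a b) ∧
    (∀ b : Fin n → ℕ, ∑ i, a i = ∑ i, b i →
      Module.finrank ℂ
          ((TFunctor n).obj (USet.ofTuple a) ⟶ (TFunctor n).obj (USet.ofTuple b)) =
        (∏ i, (b i).factorial) *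
          ∏ i : Fin n with i.val + 1 < n,
            ((∑ j ∈ Finset.Iic i, a j) - ∑ j ∈ Finset.Iio i, b j).choose (b i)) ∧
    -- (2) `K_a = ⨂ᵢ 𝐕_{(i)}^{⊗ aᵢ}` inside `T_a`, as representations of `𝐆`
    (∃ e : GrTRep (USet.ofTuple a) ≅ KRep (USet.ofTuple a),
      e.hom ≫ KIncl (USet.ofTuple a) = grTIncl (USet.ofTuple a)) := by
  have : NeZero n := ⟨by omega⟩
  exact ⟨isFiniteModule_homT _,
    ⟨princProjIso _, fun _ φ => princProjIso_hom_app_single φ⟩,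
    ⟨princProjIsoDual _, fun _ φ => princProjIsoDual_hom_app_single φ⟩,
    fun _ => nontrivial_hom_iff.trans nonempty_hom_iff,
    fun _ h => (finrank_hom _ _).trans (card_hom_eq_choose h),
    ⟨asIso (grToK _), grToK_comp_KIncl _⟩⟩
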